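/- Let $\Delta$ be a set (for instance $\Delta\subseteq\mathbb{R}^{n}$) with a $\sigma$-algebra $\mathcal{D}$ and a probability measure $\mathbb{P}$ on $\mathcal{D}$. For $C\in\mathcal D$ let $\mathbb 1_C:\Delta\to\{0,1\}$ be its indicator function. For $T,H\in\mathcal{D}$ put $d_{\mathbb{P}}(T,H)=\mathbb{P}\{\delta\in\Delta:\mathbb 1_H(\delta)\neq\mathbb 1_T(\delta)\}$, and call $H$ consistent with the labeled samples $\{(\delta_i,\mathbb 1_T(\delta_i))\}_{i\in J}$ if $\mathbb 1_H(\delta_i)=\mathbb 1_T(\delta_i)$ for all $i\in J$. Let $d\in\mathbb{N}$; for $m\ge d$ let $\mathcal{I}_d$ be the set of all $d$-element subsets of $\{1,\dots,m\}$. Fix a target concept $T\in\mathcal{D}$ and a map $G_d:[\Delta\times\{0,1\}]^d\to\mathcal{D}$. For $m\ge d$, $I_d\in\mathcal{I}_d$ and samples $\{\delta_i\}_{i\in I_d}$ put $H_{I_d}=G_d\big(\{(\delta_i,\mathbb 1_T(\delta_i))\}_{i\in I_d}\big)$, where the samples are listed in increasing order of the index. Suppose that: 1. for all $m\ge d$,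 all $I_d\in\mathcal{I}_d$ and all $\{\delta_i\}_{i\in I_d}\in\Delta^d$, $H_{I_d}$ is consistent with $\{(\delta_i,\mathbb 1_T(\delta_i))\}_{i\in I_d}$; 2. for every $m\ge d$, for $\mathbb{P}^m$-almost every $(\delta_1,\dots,\delta_m)\in\Delta^m$ there is exactly one $I_d\in\mathcal{I}_d$ such that $H_{I_d}$ is consistent with $\{(\delta_i,\mathbb 1_T(\delta_i))\}_{i=1}^m$; 3. (measurability) for all $m\ge d$ and $I_d\in\mathcal{I}_d$ the set $S_{I_d}=\big\{(\delta_1,\dots,\delta_m)\in\Delta^m: H_{I_d}\text{ is consistent with }\{(\delta_i,\mathbb 1_T(\delta_i))\}_{i=1}^m\big\}$ is measurable with respect to the product $\sigma$-algebra. Then for every $m\ge d$, every $I_d\in\mathcal{I}_d$ and every $\alpha\in[0,1]$, $$F(\alpha)=\mathbb{P}^d\big\{\{\delta_i\}_{i\in I_d}\in\Delta^d:\ d_{\mathbb{P}}(T,H_{I_d})\le\alpha\big\}=\alpha^d$$ (with $0^0=1$ if $d=0$). -/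

import Mathlib

open MeasureTheory

namespace CompressionLearning

/-- Concepts: the elements of the sigma-algebra on `Δ`. -/
abbrev Concept (Δ : Type*) [MeasurableSpace Δ] : Type _ := {C : Set Δ // MeasurableSet C}

/-- `IndexSet m d`: the sets of `d` indices from an `m`-element index range. -/
abbrev IndexSet (m d : ℕ) : Type := {I : Finset (Fin m) // I.card = d}

section

variable {Δ : Type*} [MeasurableSpace Δ]

/-- The indicator function of a concept, with values in `{0, 1}`. -/
noncomputable def ind (C : Concept Δ) (δ : Δ) : Fin 2 := C.1.indicator (fun _ => 1) δ

/-- The labeled multisample `(δ i, 1_T (δ i))`. -/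
noncomputable def labeled {ι : Type*} (T : Concept Δ) (δ : ι → Δ) : ι → Δ × Fin 2 :=
  fun i => (δ i, ind T (δ i))

/-- A hypothesis is consistent with a labeled multisample if it gives every sample its label. -/
def Consistent {ι : Type*} (H : Concept Δ) (s : ι → Δ × Fin 2) : Prop :=
  ∀ i, ind H (s i).1 = (s i).2

/-- The error `P {δ | 1_H δ ≠ 1_T δ}` of `H` as an approximation of `T`. -/
noncomputable def error (P : Measure Δ) (T H : Concept Δ) : ℝ :=
  P.real {δ | ind H δ ≠ ind T δ}

/-- The hypothesis that `G` builds from the labeled samples with index in `I`, which are fed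
to `G` in increasing order of the index. -/
noncomputable def hyp {m d : ℕ} (G : (Fin d → Δ × Fin 2) → Concept Δ) (T : Concept Δ)
    (I : IndexSet m d) (x : I.1 → Δ) : Concept Δ :=
  G fun k => labeled T x (I.1.orderIsoOfFin I.2 k)

/-- The set of `m`-multisamples `δ` such that the hypothesis built from the samples with index
in `I` is consistent with the whole labeled `m`-multisample. -/
def consistencySet {m d : ℕ} (G : (Fin d → Δ × Fin 2) → Concept Δ) (T : Concept Δ)
    (I : IndexSet m d) : Set (Fin m → Δ) :=
  {δ | Consistent (hyp G T I (fun i => δ i)) (labeled T δ)}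

/-- The unique compression assumption on a map `G` of labeled `d`-multisamples. -/
structure UniqueCompression (P : Measure Δ) (T : Concept Δ) (d : ℕ)
    (G : (Fin d → Δ × Fin 2) → Concept Δ) : Prop where
  /-- The hypothesis built from `d` labeled samples is consistent with these samples. -/
  consistent : ∀ m, d ≤ m → ∀ (I : IndexSet m d) (x : I.1 → Δ),
    Consistent (hyp G T I x) (labeled T x)
  /-- For every `m ≥ d`, with probability one there is exactly one set of `d` indices whose
  hypothesis is consistent with the whole labeled `m`-multisample. -/
  existsUnique : ∀ m, d ≤ m → ∀ᵐ δ ∂(Measure.pi fun _ : Fin m => P),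
    ∃! I : IndexSet m d, Consistent (hyp G T I (fun i => δ i)) (labeled T δ)

/-- The distribution function of the error of the hypothesis built from the samples with index
in `I`, where these `d` samples are drawn independently according to `P`. -/
noncomputable def errorDistribution {m d : ℕ} (P : Measure Δ)
    (G : (Fin d → Δ × Fin 2) → Concept Δ) (T : Concept Δ) (I : IndexSet m d) (α : ℝ) : ℝ :=
  (Measure.pi fun _ : I.1 => P).real {x | error P T (hyp G T I x) ≤ α}

end

end CompressionLearning

namespace CompressionLearning

open Set Polynomial BoundedContinuousFunction

/-! Let `A` be the probability that the hypothesis built from `d` random samples labels a fresh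
sample as `T` does, so that the error is `1 - A`. Given the samples with index in `I`, consistency
with them is automatic, and each of the other `m - d` samples is labeled correctly independently
with probability `A`. Hence `consistencySet G T I` has probability `E[A ^ (m - d)]`, whatever `I` is
(`measure_consistencySet`). By unique compression these sets partition the multisamples up to a null
set, so `E[A ^ k] = 1 / (d + k).choose d` for every `k` (`lintegral_agreement_pow`). For `d ≥ 1`
these are the moments of the Beta law with density `d * (1 - x) ^ (d - 1)`. A law on `[0, 1]` is
determined by its moments (`ext_of_integral_pow_eq`), and the Beta tail gives `P(A ≥ 1 - α) = α ^
d`. -/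

/-! ### The moment problem on a bounded interval and the Beta law. -/

/-- Finite measures on the line that live on `[a, b]` and have the same moments are equal. -/
theorem ext_of_integral_pow_eq {a b : ℝ} {μ ν : Measure ℝ} [IsFiniteMeasure μ] [IsFiniteMeasure ν]
    (hμ : ∀ᵐ x ∂μ, x ∈ Icc a b) (hν : ∀ᵐ x ∂ν, x ∈ Icc a b)
    (h : ∀ k : ℕ, ∫ x, x ^ k ∂μ = ∫ x, x ^ k ∂ν) : μ = ν := by
  have integrable_of_continuous : ∀ (ρ : Measure ℝ) [IsFiniteMeasure ρ],
      (∀ᵐ x ∂ρ, x ∈ Icc a b) → ∀ f : ℝ → ℝ, Continuous f → Integrable f ρ := by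
    intro ρ _ hρ f hf
    obtain ⟨C, hC⟩ := isCompact_Icc.exists_bound_of_continuousOn (hf.continuousOn (s := Icc a b))
    exact Integrable.of_bound hf.aestronglyMeasurable C (hρ.mono fun x hx => hC x hx)
  have integral_eval : ∀ p : ℝ[X], ∫ x, p.eval x ∂μ = ∫ x, p.eval x ∂ν := by
    intro p
    simp_rw [eval_eq_sum_range]
    rw [integral_finsetSum, integral_finsetSum]
    · simp_rw [integral_const_mul, h]
    · exact fun i _ => integrable_of_continuous ν hν _ (by fun_prop)
    · exact fun i _ => integrable_of_continuous μ hμ _ (by fun_prop)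
  have near : ∀ (ρ : Measure ℝ) [IsFiniteMeasure ρ], (∀ᵐ x ∂ρ, x ∈ Icc a b) →
      ∀ (f : ℝ → ℝ) (p : ℝ[X]) (ε : ℝ), Continuous f →
      (∀ x ∈ Icc a b, |p.eval x - f x| < ε) →
      |∫ x, p.eval x ∂ρ - ∫ x, f x ∂ρ| ≤ ε * ρ.real univ := by
    intro ρ _ hρ f p ε hf hp
    rw [← integral_sub (integrable_of_continuous ρ hρ _ p.continuous)
      (integrable_of_continuous ρ hρ _ hf), ← Real.norm_eq_abs]
    exact norm_integral_le_of_norm_le_const (hρ.mono fun x hx => (hp x hx).le)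
  refine ext_of_forall_integral_eq_of_IsFiniteMeasure fun f => ?_
  refine eq_of_forall_dist_le fun ε hε => ?_
  rw [Real.dist_eq]
  -- Weierstrass approximation within `ε / M` costs at most `ε` over both measures; the `+ 1` keeps
  -- `M` positive if both vanish.
  set M := μ.real univ + ν.real univ + 1 with hM
  have hM0 : 0 < M := by positivity
  obtain ⟨p, hp⟩ := exists_polynomial_near_of_continuousOn a b f f.continuous.continuousOn
    (ε / M) (by positivity)
  have h₁ := near μ hμ f p _ f.continuous hp
  have h₂ := near ν hν f p _ f.continuous hp
  rw [integral_eval p] at h₁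
  calc |∫ x, f x ∂μ - ∫ x, f x ∂ν|
      ≤ ε / M * μ.real univ + ε / M * ν.real univ := by
        rw [abs_le] at h₁ h₂ ⊢
        constructor <;> linarith [h₁.1, h₁.2, h₂.1, h₂.2]
    _ ≤ ε / M * M := by
        rw [← mul_add]
        gcongr
        linarith
    _ = ε := by field_simp

/-- Euler's Beta integral. Expanding one factor `1 - x` lowers `n` but raises `k` in one term, so
the induction needs all `k`. -/
theorem integral_pow_mul_one_sub_pow (k n : ℕ) :
    ∫ x in (0 : ℝ)..1, x ^ k * (1 - x) ^ n =
      (k.factorial * n.factorial : ℝ) / (k + n + 1).factorial := by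
  induction n generalizing k with
  | zero =>
    simp [Nat.factorial_succ, integral_pow]
    field_simp
  | succ n ih =>
    have hsplit : ∀ x : ℝ, x ^ k * (1 - x) ^ (n + 1) =
        x ^ k * (1 - x) ^ n - x ^ (k + 1) * (1 - x) ^ n := fun x => by ring
    simp_rw [hsplit]
    rw [intervalIntegral.integral_sub (Continuous.intervalIntegrable (by fun_prop) _ _)
      (Continuous.intervalIntegrable (by fun_prop) _ _), ih, ih,
      show k + 1 + n + 1 = k + n + 1 + 1 by ring, show k + (n + 1) + 1 = k + n + 1 + 1 by ring,
      Nat.factorial_succ (k + n + 1), Nat.factorial_succ k, Nat.factorial_succ n]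
    push_cast
    field_simp
    ring

/-- A law on `[0, 1]` with the moments `1 / (d + k).choose d` has the tail function `α ^ d`. -/
theorem measureReal_Ici_one_sub_eq_pow {μ : Measure ℝ} [IsProbabilityMeasure μ] {d : ℕ}
    (hμ : ∀ᵐ x ∂μ, x ∈ Icc (0 : ℝ) 1)
    (hmom : ∀ k : ℕ, ∫ x, x ^ k ∂μ = ((d + k).choose d : ℝ)⁻¹)
    {α : ℝ} (hα : α ∈ Icc (0 : ℝ) 1) : μ.real (Ici (1 - α)) = α ^ d := by
  rcases d with _ | n
  -- For `d = 0` all moments are `1` and the law has an atom at `1`, not a density; the closed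
  -- half-line contains it even for `α = 0`.
  · have : μ = Measure.dirac 1 :=
      ext_of_integral_pow_eq hμ (by simp [ae_dirac_eq]) (by simpa using hmom)
    subst this
    have h1 : (1 : ℝ) ∈ Ici (1 - α) := by simpa using hα.1
    simp [Measure.real, Measure.dirac_apply' _ measurableSet_Ici, h1]
  · let φ : ℝ → ℝ := fun x => (n + 1) * (1 - x) ^ n
    have hφ : Continuous φ := by fun_prop
    have hφ0 : ∀ x ∈ Ioc (0 : ℝ) 1, 0 ≤ φ x := fun x hx =>
      mul_nonneg (by positivity) (pow_nonneg (sub_nonneg.2 hx.2) _)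
    let ν : Measure ℝ := (volume.restrict (Ioc 0 1)).withDensity fun x => ENNReal.ofReal (φ x)
    have hφi : Integrable φ (volume.restrict (Ioc (0 : ℝ) 1)) :=
      (hφ.integrableOn_Icc (a := 0) (b := 1)).mono_set Ioc_subset_Icc_self
    have : IsFiniteMeasure ν := isFiniteMeasure_withDensity_ofReal hφi.2
    have hνint : ∀ f : ℝ → ℝ, ∫ x, f x ∂ν = ∫ x in Ioc (0 : ℝ) 1, φ x * f x := by
      intro f
      rw [integral_withDensity_eq_integral_toReal_smul (by fun_prop) (by simp)]
      refine setIntegral_congr_fun measurableSet_Ioc fun x hx => ?_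
      simp [ENNReal.toReal_ofReal (hφ0 x hx)]
    have hν : ∀ᵐ x ∂ν, x ∈ Icc (0 : ℝ) 1 :=
      (withDensity_absolutelyContinuous _ _).ae_le
        ((ae_restrict_mem measurableSet_Ioc).mono fun x hx => Ioc_subset_Icc_self hx)
    have hμν : μ = ν := by
      refine ext_of_integral_pow_eq hμ hν fun k => ?_
      rw [hmom, hνint, ← intervalIntegral.integral_of_le zero_le_one]
      have : ∀ x : ℝ, φ x * x ^ k = (n + 1) * (x ^ k * (1 - x) ^ n) := fun x => by
        simp only [φ]; ring
      simp_rw [this]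
      rw [intervalIntegral.integral_const_mul, integral_pow_mul_one_sub_pow,
        Nat.cast_add_choose, Nat.factorial_succ n, show n + 1 + k = k + n + 1 by ring]
      push_cast
      field_simp
    rw [hμν, ← integral_indicator_one measurableSet_Ici, hνint]
    have : ∀ x, φ x * (Ici (1 - α)).indicator 1 x = (Ici (1 - α)).indicator φ x := fun x => by
      by_cases hx : x ∈ Ici (1 - α) <;> simp [hx]
    simp_rw [this]
    rw [← integral_Icc_eq_integral_Ioc, setIntegral_indicator measurableSet_Ici]
    have hset : Icc (0 : ℝ) 1 ∩ Ici (1 - α) = Icc (1 - α) 1 := by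
      ext x
      simp only [mem_inter_iff, mem_Icc, mem_Ici]
      constructor
      · exact fun h => ⟨h.2, h.1.2⟩
      · exact fun h => ⟨⟨by linarith [hα.2, h.1], h.2⟩, h.1⟩
    rw [hset, integral_Icc_eq_integral_Ioc,
      ← intervalIntegral.integral_of_le (by linarith [hα.1]),
      intervalIntegral.integral_const_mul,
      intervalIntegral.integral_comp_sub_left (fun x => x ^ n) (1 : ℝ)]
    simp [integral_pow]
    field_simp

/-! ### Splitting a multisample, and the moments of the agreement. -/

section

variable {Δ : Type*} [MeasurableSpace Δ]

theorem measurable_ind (C : Concept Δ) : Measurable (ind C) :=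
  (measurable_const.indicator C.2 : Measurable (C.1.indicator fun _ => (1 : Fin 2)))

theorem measurableSet_ind_eq (C D : Concept Δ) : MeasurableSet {δ | ind C δ = ind D δ} :=
  measurableSet_eq_fun (measurable_ind C) (measurable_ind D)

/-- The hypothesis that `G` builds from the samples `z`, labeled by `T`. -/
noncomputable def hypFin {d : ℕ} (G : (Fin d → Δ × Fin 2) → Concept Δ) (T : Concept Δ)
    (z : Fin d → Δ) : Concept Δ :=
  G (labeled T z)

/-- The probability that the hypothesis built from `z` labels a random sample as `T` does. -/
noncomputable def agreement {d : ℕ} (P : Measure Δ) (G : (Fin d → Δ × Fin 2) → Concept Δ)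
    (T : Concept Δ) (z : Fin d → Δ) : ENNReal :=
  P {δ | ind (hypFin G T z) δ = ind T δ}

/-- Samples with index in `I`, from their list in increasing order of the index. -/
noncomputable def reindex {m d : ℕ} (I : IndexSet m d) : (Fin d → Δ) ≃ᵐ (I.1 → Δ) :=
  MeasurableEquiv.piCongrLeft (fun _ : I.1 => Δ) (I.1.orderIsoOfFin I.2).toEquiv

theorem hyp_reindex {m d : ℕ} (G : (Fin d → Δ × Fin 2) → Concept Δ) (T : Concept Δ)
    (I : IndexSet m d) (z : Fin d → Δ) : hyp G T I (reindex I z) = hypFin G T z := by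
  have : ∀ k, reindex I z (I.1.orderIsoOfFin I.2 k) = z k := fun k =>
    Equiv.piCongrLeft_apply_apply (fun _ : I.1 => Δ) (I.1.orderIsoOfFin I.2).toEquiv z k
  simp only [hyp, hypFin, labeled, this]
  rfl

theorem measurePreserving_reindex {m d : ℕ} (P : Measure Δ) [SigmaFinite P] (I : IndexSet m d) :
    MeasurePreserving (reindex (Δ := Δ) I) (Measure.pi fun _ => P) (Measure.pi fun _ => P) :=
  measurePreserving_piCongrLeft (fun _ : I.1 => P) (I.1.orderIsoOfFin I.2).toEquiv

/-- An `m`-multisample, from the ordered list of its samples with index in `I` and the family of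
the other samples. -/
noncomputable def merge {m d : ℕ} (I : IndexSet m d) :
    (Fin d → Δ) × ({i // i ∉ I.1} → Δ) ≃ᵐ (Fin m → Δ) :=
  ((reindex I).prodCongr (MeasurableEquiv.refl _)).trans
    (MeasurableEquiv.piEquivPiSubtypeProd (fun _ : Fin m => Δ) (· ∈ I.1)).symm

theorem measurePreserving_merge {m d : ℕ} (P : Measure Δ) [SigmaFinite P] (I : IndexSet m d) :
    MeasurePreserving (merge (Δ := Δ) I)
      ((Measure.pi fun _ => P).prod (Measure.pi fun _ => P)) (Measure.pi fun _ => P) := by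
  have h := (measurePreserving_piEquivPiSubtypeProd (fun _ : Fin m => P) (· ∈ I.1)).symm
  -- The two product measures are built on different `Fintype` instances of the same subtype.
  rw [Subsingleton.elim (Subtype.fintype (· ∈ I.1)) (Finset.Subtype.fintype I.1)] at h
  exact h.comp ((measurePreserving_reindex P I).prod (MeasurePreserving.id _))

theorem merge_apply_mem {m d : ℕ} (I : IndexSet m d) (p : (Fin d → Δ) × ({i // i ∉ I.1} → Δ))
    (i : I.1) : merge I p i = reindex I p.1 i := by
  change (if h : (i : Fin m) ∈ I.1 then reindex I p.1 ⟨i, h⟩ else p.2 ⟨i, h⟩) = _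
  simp

theorem merge_apply_notMem {m d : ℕ} (I : IndexSet m d) (p : (Fin d → Δ) × ({i // i ∉ I.1} → Δ))
    (i : {i // i ∉ I.1}) : merge I p i = p.2 i := by
  change (if h : (i : Fin m) ∈ I.1 then reindex I p.1 ⟨i, h⟩ else p.2 ⟨i, h⟩) = _
  rw [dif_neg i.2]

theorem merge_mem_consistencySet_iff {P : Measure Δ} {T : Concept Δ} {d : ℕ}
    {G : (Fin d → Δ × Fin 2) → Concept Δ} (hG : UniqueCompression P T d G) {m : ℕ} (hm : d ≤ m)
    (I : IndexSet m d) (p : (Fin d → Δ) × ({i // i ∉ I.1} → Δ)) :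
    merge I p ∈ consistencySet G T I ↔
      ∀ j, ind (hypFin G T p.1) (p.2 j) = ind T (p.2 j) := by
  have hfun : (fun i : I.1 => merge I p i) = reindex I p.1 := funext (merge_apply_mem I p)
  have hmem : merge I p ∈ consistencySet G T I ↔
      ∀ i, ind (hypFin G T p.1) (merge I p i) = ind T (merge I p i) := by
    simp only [consistencySet, mem_ofPred_eq, hfun, hyp_reindex]
    rfl
  rw [hmem]
  constructor
  · intro h j
    simpa [merge_apply_notMem] using h j
  · intro h i
    by_cases hi : i ∈ I.1
    · have := hG.consistent m hm I (reindex I p.1) ⟨i, hi⟩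
      rw [hyp_reindex] at this
      rw [merge_apply_mem I p ⟨i, hi⟩]
      exact this
    · rw [merge_apply_notMem I p ⟨i, hi⟩]
      exact h ⟨i, hi⟩

/-- With `z` fixed, the section is a box: one copy of the agreement event for each of the `m - d`
indices outside `I`. -/
theorem measure_section_merge {P : Measure Δ} [IsProbabilityMeasure P] {T : Concept Δ} {d : ℕ}
    {G : (Fin d → Δ × Fin 2) → Concept Δ} (hG : UniqueCompression P T d G) {m : ℕ} (hm : d ≤ m)
    (I : IndexSet m d) (z : Fin d → Δ) :
    (Measure.pi fun _ => P) (Prod.mk z ⁻¹' (merge I ⁻¹' consistencySet G T I)) =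
      agreement P G T z ^ (m - d) := by
  have hset : Prod.mk z ⁻¹' (merge I ⁻¹' consistencySet G T I) =
      univ.pi fun _ => {δ | ind (hypFin G T z) δ = ind T δ} := by
    ext y
    simp [merge_mem_consistencySet_iff hG hm]
  have hcard : Fintype.card {i // i ∉ I.1} = m - d := by
    simp [Fintype.card_subtype_compl, I.2]
  rw [hset, Measure.pi_pi, Finset.prod_const, Finset.card_univ, hcard]
  rfl

/-- For `m = d + 1` one sample is left over, so the agreement is itself the section measure of a
measurable set. -/
theorem measurable_agreement {P : Measure Δ} [IsProbabilityMeasure P] {T : Concept Δ} {d : ℕ}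
    {G : (Fin d → Δ × Fin 2) → Concept Δ} (hG : UniqueCompression P T d G)
    (hmeas : ∀ m, d ≤ m → ∀ I : IndexSet m d, MeasurableSet (consistencySet G T I)) :
    Measurable (agreement P G T) := by
  obtain ⟨I, -, hI⟩ := Finset.exists_subset_card_eq (s := (Finset.univ : Finset (Fin (d + 1))))
    (n := d) (by simp)
  obtain ⟨J, -⟩ : ∃ J : IndexSet (d + 1) d, J.1 = I := ⟨⟨I, hI⟩, rfl⟩
  have hS := (merge (Δ := Δ) J).measurable (hmeas (d + 1) (by omega) J)
  have h := measurable_measure_prodMk_left (ν := Measure.pi fun _ => P) hS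
  simpa [measure_section_merge hG (Nat.le_add_right d 1)] using h

theorem measure_consistencySet {P : Measure Δ} [IsProbabilityMeasure P] {T : Concept Δ} {d : ℕ}
    {G : (Fin d → Δ × Fin 2) → Concept Δ} (hG : UniqueCompression P T d G)
    {m : ℕ} (hm : d ≤ m) (I : IndexSet m d) (hmeas : MeasurableSet (consistencySet G T I)) :
    (Measure.pi fun _ => P) (consistencySet G T I) =
      ∫⁻ z, agreement P G T z ^ (m - d) ∂(Measure.pi fun _ => P) := by
  rw [← (measurePreserving_merge P I).measure_preimage hmeas.nullMeasurableSet,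
    Measure.prod_apply ((merge I).measurable hmeas)]
  simp_rw [measure_section_merge hG hm]

theorem lintegral_agreement_pow {P : Measure Δ} [IsProbabilityMeasure P] {T : Concept Δ} {d : ℕ}
    {G : (Fin d → Δ × Fin 2) → Concept Δ} (hG : UniqueCompression P T d G)
    (hmeas : ∀ m, d ≤ m → ∀ I : IndexSet m d, MeasurableSet (consistencySet G T I)) (k : ℕ) :
    ∫⁻ z, agreement P G T z ^ k ∂(Measure.pi fun _ => P) = ((d + k).choose d : ENNReal)⁻¹ := by
  have hm : d ≤ d + k := Nat.le_add_right d k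
  have hcard : Fintype.card (IndexSet (d + k) d) = (d + k).choose d := by
    rw [Fintype.card_finset_len, Fintype.card_fin]
  have hcover : ∀ᵐ δ ∂(Measure.pi fun _ : Fin (d + k) => P),
      δ ∈ ⋃ I : IndexSet (d + k) d, consistencySet G T I :=
    (hG.existsUnique _ hm).mono fun δ h => mem_iUnion.2 h.exists
  -- Existence of the index set gives the cover, uniqueness the disjointness, both almost
  -- everywhere.
  have hdisj : Pairwise (Function.onFun (AEDisjoint (Measure.pi fun _ : Fin (d + k) => P))
      fun I : IndexSet (d + k) d => consistencySet G T I) := fun I J hIJ =>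
    measure_eq_zero_iff_ae_notMem.2 ((hG.existsUnique _ hm).mono fun δ h hδ =>
      hIJ (h.unique hδ.1 hδ.2))
  have hone := measure_iUnion₀ hdisj fun I => (hmeas _ hm I).nullMeasurableSet
  rw [(mem_ae_iff_prob_eq_one (MeasurableSet.iUnion fun I => hmeas _ hm I)).1 hcover,
    tsum_fintype] at hone
  simp_rw [measure_consistencySet hG hm _ (hmeas _ hm _), Nat.add_sub_cancel_left] at hone
  rw [Finset.sum_const, Finset.card_univ, hcard, nsmul_eq_mul, mul_comm] at hone
  exact ENNReal.eq_inv_of_mul_eq_one_left hone.symm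

theorem error_le_iff {P : Measure Δ} [IsProbabilityMeasure P] {T : Concept Δ} {d : ℕ}
    (G : (Fin d → Δ × Fin 2) → Concept Δ) (z : Fin d → Δ) (α : ℝ) :
    error P T (hypFin G T z) ≤ α ↔ 1 - α ≤ (agreement P G T z).toReal := by
  have : error P T (hypFin G T z) = 1 - (agreement P G T z).toReal :=
    probReal_compl_eq_one_sub (measurableSet_ind_eq (hypFin G T z) T)
  rw [this, sub_le_comm]

end

end CompressionLearning

open CompressionLearning in
theorem mainTheorem2 {Δ : Type*} [MeasurableSpace Δ] (P : MeasureTheory.Measure Δ)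
    [MeasureTheory.IsProbabilityMeasure P] (T : CompressionLearning.Concept Δ) (d : ℕ)
    (G : (Fin d → Δ × Fin 2) → CompressionLearning.Concept Δ)
    (hG : CompressionLearning.UniqueCompression P T d G)
    (hmeas : ∀ m, d ≤ m → ∀ I : CompressionLearning.IndexSet m d,
      MeasurableSet (CompressionLearning.consistencySet G T I))
    (m : ℕ) (hm : d ≤ m) (I : CompressionLearning.IndexSet m d)
    (α : ℝ) (hα : α ∈ Set.Icc (0 : ℝ) 1) :
    CompressionLearning.errorDistribution P G T I α = α ^ d := by
  have hA := (measurable_agreement hG hmeas).ennreal_toReal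
  have hle : ∀ z, agreement P G T z ≤ 1 := fun z => prob_le_one
  have := Measure.isProbabilityMeasure_map (μ := Measure.pi fun _ : Fin d => P) hA.aemeasurable
  have htail := measureReal_Ici_one_sub_eq_pow
    (μ := (Measure.pi fun _ : Fin d => P).map fun z => (agreement P G T z).toReal) (d := d)
    ((ae_map_iff hA.aemeasurable measurableSet_Icc).2 (.of_forall fun z =>
      ⟨ENNReal.toReal_nonneg, ENNReal.toReal_le_of_le_ofReal zero_le_one (by simpa using hle z)⟩))
    (fun k => by
      rw [integral_map hA.aemeasurable (by fun_prop)]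
      simp_rw [← ENNReal.toReal_pow]
      rw [integral_toReal ((measurable_agreement hG hmeas).pow_const k).aemeasurable
        (.of_forall fun z => ENNReal.pow_lt_top ((hle z).trans_lt ENNReal.one_lt_top)),
        lintegral_agreement_pow hG hmeas k]
      simp) hα
  rw [map_measureReal_apply hA measurableSet_Ici] at htail
  rw [← htail, errorDistribution, measureReal_def, measureReal_def,
    -- Since `reindex I` is a measurable equivalence, no measurability of the error event in `I.1 →
    -- Δ` has to be checked.
    ← (measurePreserving_reindex P I).measure_preimage_equiv]
  simp only [Set.preimage_ofPred_eq, hyp_reindex, error_le_iff]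
  rfl
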